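/- Let $p>1$ be a real number and let $G$ be a countably infinite connected graph of bounded degree without self-loops, with vertex set $V$; write $N_x$ for the set of neighbors of $x\in V$ and fix a vertex $o\in V$. For $f\colon V\to\mathbb R$ put $$I_p(f,V)=\sum_{x\in V}\sum_{y\in N_x}|f(y)-f(x)|^p,\qquad \Delta_pf(x)=\sum_{y\in N_x}|f(y)-f(x)|^{p-2}(f(y)-f(x)),$$ where summands of $\Delta_p f(x)$ with $f(y)=f(x)$ are $0$. Let $D_p(G)$ be the space of $f\colon V\to\mathbb R$ with $I_p(f,V)<\infty$, with norm $\|f\|_{D_p}=(I_p(f,V)+|f(o)|^p)^{1/p}$; let $BD_p(G)$ be the algebra, under pointwise operations, of the bounded functions in $D_p(G)$; and let $BHD_p(G)$ be the set of $h\in BD_p(G)$ with $\Delta_ph=0$ on $V$. Let $Sp(BD_p(G))$ be the set of nonzero real-algebra homomorphisms $\tau\colon BD_p(G)\to\mathbb C$, and for $f\in BD_p(G)$ let $\hat f(\tau)=\tau(f)$ be its Gelfand transform, which is real-valued. Identify $x\in V$ with the homomorphism $f\mapsto f(x)$. Let $B(\overline{\mathbb RG})_{D_p}$ be the set of bounded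 functions in the closure in $D_p(G)$ of the finitely supported functions. The $p$-harmonic boundary of $G$ is $$\partial_p(G)=\{\tau\in Sp(BD_p(G))\setminus V \mid \hat f(\tau)=0\text{ for all } f\in B(\overline{\mathbb RG})_{D_p}\}.$$ **Theorem (Maximum principle).** Let $h$ be a nonconstant function in $BHD_p(G)$ and suppose $a$ and $b$ are real numbers for which $a\le\hat h\le b$ on $\partial_p(G)$. Then $a<h<b$ on $V$. -/

import Mathlib

noncomputable section

namespace PHarmonic

variable {V : Type*} (G : SimpleGraph V) [G.LocallyFinite] (p : ℝ)

/-- The `p`-th power of the gradient, `|Df(x)|^p = ∑_{y ∈ N_x} |f(y) - f(x)|^p`. -/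
def gradPow (f : V → ℝ) (x : V) : ℝ :=
  ∑ y ∈ G.neighborFinset x, |f y - f x| ^ p

/-- The `p`-Laplacian `Δ_p f(x) = ∑_{y ∈ N_x} |f(y) - f(x)|^(p-2) (f(y) - f(x))`.
Terms with `f y = f x` are `0` for every `p`, because of the last factor. -/
def pLaplacian (f : V → ℝ) (x : V) : ℝ :=
  ∑ y ∈ G.neighborFinset x, |f y - f x| ^ (p - 2) * (f y - f x)

/-- `f` is `p`-harmonic on the whole vertex set. -/
def IsPHarmonic (f : V → ℝ) : Prop :=
  ∀ x, pLaplacian G p f x = 0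

/-- `f` has finite `p`-Dirichlet sum over `V`, i.e. `f ∈ D_p(G)`
(the terms `|Df(x)|^p` are nonnegative). -/
def DirichletFinite (f : V → ℝ) : Prop :=
  Summable (gradPow G p f)

/-- The `p`-Dirichlet sum `I_p(f, V)` of a function `f ∈ D_p(G)`. -/
def dirichletSum (f : V → ℝ) : ℝ :=
  ∑' x, gradPow G p f x

/-- The norm `(I_p(f, V) + |f(o)|^p)^(1/p)` of `D_p(G)`, with base vertex `o`. -/
def dirichletNorm (o : V) (f : V → ℝ) : ℝ :=
  (dirichletSum G p f + |f o| ^ p) ^ (1 / p)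

variable {G p}

theorem gradPow_nonneg (f : V → ℝ) (x : V) : 0 ≤ gradPow G p f x :=
  Finset.sum_nonneg fun _ _ => by positivity

/-- If every increment of `k` along an edge is at most `A` times that of `f` plus `B` times that
of `g`, with `f` and `g` in `D_p(G)`, then `k` is in `D_p(G)`. -/
theorem DirichletFinite.of_increment_le (hp : 1 < p) {f g k : V → ℝ} {A B : ℝ}
    (hA : 0 ≤ A) (hB : 0 ≤ B) (hf : DirichletFinite G p f) (hg : DirichletFinite G p g)
    (hk : ∀ x y, |k y - k x| ≤ A * |f y - f x| + B * |g y - g x|) :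
    DirichletFinite G p k := by
  have hp0 : 0 ≤ p := by linarith
  refine Summable.of_nonneg_of_le (gradPow_nonneg k) (fun x => ?_)
    ((hf.mul_left (2 ^ (p - 1) * A ^ p)).add (hg.mul_left (2 ^ (p - 1) * B ^ p)))
  simp only [gradPow, Finset.mul_sum]
  rw [← Finset.sum_add_distrib]
  refine Finset.sum_le_sum fun y _ => ?_
  have h1 := abs_nonneg (f y - f x)
  have h2 := abs_nonneg (g y - g x)
  calc |k y - k x| ^ p
      ≤ (A * |f y - f x| + B * |g y - g x|) ^ p :=
        Real.rpow_le_rpow (abs_nonneg _) (hk x y) hp0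
    _ ≤ 2 ^ (p - 1) * ((A * |f y - f x|) ^ p + (B * |g y - g x|) ^ p) :=
        mod_cast NNReal.rpow_add_le_mul_rpow_add_rpow
          ⟨A * |f y - f x|, by positivity⟩ ⟨B * |g y - g x|, by positivity⟩ hp.le
    _ = _ := by
        rw [Real.mul_rpow hA h1, Real.mul_rpow hB h2]; ring

theorem dirichletFinite_const (hp : 1 < p) (c : ℝ) : DirichletFinite G p (fun _ => c) := by
  have hp0 : p ≠ 0 := by linarith
  have h : gradPow G p (fun _ : V => c) = fun _ => 0 := by
    funext x
    simp [gradPow, Real.zero_rpow hp0]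
  simpa only [DirichletFinite, h] using summable_zero

variable (G)

/-- The algebra `BD_p(G)` of bounded real functions on `V` with finite `p`-Dirichlet sum, under
pointwise operations. -/
def BD (hp : 1 < p) : Subalgebra ℝ (V → ℝ) where
  carrier := {f | DirichletFinite G p f ∧ ∃ M, ∀ x, |f x| ≤ M}
  mul_mem' := by
    rintro f g ⟨hf, M, hM⟩ ⟨hg, N, hN⟩
    refine ⟨DirichletFinite.of_increment_le hp (abs_nonneg N) (abs_nonneg M) hf hg
      fun x y => ?_, M * N, fun x => ?_⟩
    · have e : (f * g) y - (f * g) x = g y * (f y - f x) + f x * (g y - g x) := by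
        simp only [Pi.mul_apply]; ring
      rw [e]
      refine (abs_add_le _ _).trans ?_
      rw [abs_mul, abs_mul]
      exact add_le_add
        (mul_le_mul_of_nonneg_right ((hN y).trans (le_abs_self N)) (abs_nonneg _))
        (mul_le_mul_of_nonneg_right ((hM x).trans (le_abs_self M)) (abs_nonneg _))
    · rw [Pi.mul_apply, abs_mul]
      exact mul_le_mul (hM x) (hN x) (abs_nonneg _) ((abs_nonneg _).trans (hM x))
  add_mem' := by
    rintro f g ⟨hf, M, hM⟩ ⟨hg, N, hN⟩
    refine ⟨DirichletFinite.of_increment_le hp zero_le_one zero_le_one hf hg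
      fun x y => ?_, M + N, fun x => ?_⟩
    · have e : (f + g) y - (f + g) x = (f y - f x) + (g y - g x) := by
        simp only [Pi.add_apply]; ring
      rw [e, one_mul, one_mul]
      exact abs_add_le _ _
    · exact (abs_add_le _ _).trans (add_le_add (hM x) (hN x))
  algebraMap_mem' c := ⟨dirichletFinite_const hp c, |c|, fun _ => le_rfl⟩

/-- The spectrum `Sp(BD_p(G))`: the nonzero homomorphisms of real algebras from `BD_p(G)` to `ℂ`.
As `BD_p(G)` has a unit and `ℂ` is a field, these are exactly the unital homomorphisms. -/
abbrev Spectrum (hp : 1 < p) : Type _ := BD G hp →ₐ[ℝ] ℂ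

/-- The Gelfand transform `f̂(τ) = τ(f)`. -/
def gelfand {hp : 1 < p} (f : BD G hp) (τ : Spectrum G hp) : ℂ := τ f

/-- The map `i : V → Sp(BD_p(G))`, `i(x)(f) = f(x)`. -/
def evalChar (hp : 1 < p) (x : V) : Spectrum G hp :=
  (Complex.ofRealAm.comp (Pi.evalAlgHom ℝ (fun _ : V => ℝ) x)).comp (BD G hp).val

/-- The `p`-Royden boundary `R_p(G) = Sp(BD_p(G)) \ i(V)`. -/
def roydenBoundary (hp : 1 < p) : Set (Spectrum G hp) :=
  (Set.range (evalChar G hp))ᶜ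

/-- `B(closure of ℝG in D_p)`: the elements of `BD_p(G)` that are limits, in the norm of `D_p(G)`,
of finitely supported functions. -/
def bddClosureFinSupp (hp : 1 < p) (o : V) : Set (BD G hp) :=
  {f | ∀ ε > 0, ∃ g : V → ℝ, (Function.support g).Finite ∧
    dirichletNorm G p o ((f : V → ℝ) - g) < ε}

/-- The `p`-harmonic boundary `∂_p(G)`: the points of the `p`-Royden boundary at which the Gelfand
transforms of all bounded functions in the `D_p`-closure of `ℝG` vanish. -/
def harmonicBoundary (hp : 1 < p) (o : V) : Set (Spectrum G hp) :=
  {τ ∈ roydenBoundary G hp | ∀ f ∈ bddClosureFinSupp G hp o, gelfand G f τ = 0}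

/-- `BHD_p(G)`: the bounded `p`-harmonic functions with finite `p`-Dirichlet sum. -/
def BHD (hp : 1 < p) : Set (BD G hp) :=
  {h | IsPHarmonic G p (h : V → ℝ)}

end PHarmonic

end

open Filter Topology

namespace PHarmonic

/-! For `c < a`, test harmonicity of `h` against the truncation `w = max (c - h) 0`. If `w` is null
in the sense of `IsNull`, summation by parts survives the limit (`IsNull.tsum_pairing_eq_zero`),
while the pairing dominates the energy of `w` up to sign (`rpow_le_of_truncation`). So `w` has zero
energy and is constant; were it positive, `h` would be constant. Hence `c ≤ h`, and `c → a` gives `a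
≤ h`.

Why `w` is null: if some null function is at least 1 on `{h ≤ c}`, a multiple of it dominates `w`.
Otherwise an ultrafilter on `{h ≤ c}` kills all null functions in the limit; limits along it form a
character in the harmonic boundary where `ĥ ≤ c < a`, a contradiction.

Strictness is the strong minimum principle (`lt_of_forall_le`), and the upper bound is the lower one
for `-h`. -/

theorem eq_of_forall_adj {V : Type*} {G : SimpleGraph V} (hconn : G.Connected)
    {f : V → ℝ}
    (hf : ∀ x y, G.Adj x y → f y = f x) (x y : V) : f y = f x := by
  obtain ⟨q⟩ := hconn.preconnected x y
  induction q with
  | nil => rfl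
  | cons hadj _ ih => rw [ih, hf _ _ hadj]

variable {V : Type*} {G : SimpleGraph V} [G.LocallyFinite] {p : ℝ}

/-! ### Estimates for Dirichlet sums -/

theorem abs_sub_rpow_le_gradPow (f : V → ℝ) {x y : V} (hxy : G.Adj x y) :
    |f y - f x| ^ p ≤ gradPow G p f x :=
  Finset.single_le_sum (f := fun y => |f y - f x| ^ p) (fun _ _ => by positivity)
    ((G.mem_neighborFinset x y).2 hxy)

theorem dirichletSum_nonneg (f : V → ℝ) : 0 ≤ dirichletSum G p f :=
  tsum_nonneg (gradPow_nonneg f)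

theorem gradPow_le_of_increment_le (hp : 1 < p) {f g k : V → ℝ} {A B : ℝ}
    (hA : 0 ≤ A) (hB : 0 ≤ B)
    (hk : ∀ x y, |k y - k x| ≤ A * |f y - f x| + B * |g y - g x|) (x : V) :
    gradPow G p k x ≤ 2 ^ (p - 1) * A ^ p * gradPow G p f x
      + 2 ^ (p - 1) * B ^ p * gradPow G p g x := by
  have hp0 : 0 ≤ p := by linarith
  simp only [gradPow, Finset.mul_sum]
  rw [← Finset.sum_add_distrib]
  refine Finset.sum_le_sum fun y _ => ?_
  have h1 := abs_nonneg (f y - f x)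
  have h2 := abs_nonneg (g y - g x)
  calc |k y - k x| ^ p
      ≤ (A * |f y - f x| + B * |g y - g x|) ^ p :=
        Real.rpow_le_rpow (abs_nonneg _) (hk x y) hp0
    _ ≤ 2 ^ (p - 1) * ((A * |f y - f x|) ^ p + (B * |g y - g x|) ^ p) :=
        mod_cast NNReal.rpow_add_le_mul_rpow_add_rpow
          ⟨A * |f y - f x|, by positivity⟩ ⟨B * |g y - g x|, by positivity⟩ hp.le
    _ = _ := by
        rw [Real.mul_rpow hA h1, Real.mul_rpow hB h2]; ring

theorem dirichletSum_le_of_increment_le (hp : 1 < p) {f g k : V → ℝ} {A B : ℝ}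
    (hA : 0 ≤ A) (hB : 0 ≤ B) (hf : DirichletFinite G p f) (hg : DirichletFinite G p g)
    (hk : ∀ x y, |k y - k x| ≤ A * |f y - f x| + B * |g y - g x|) :
    dirichletSum G p k ≤ 2 ^ (p - 1) * A ^ p * dirichletSum G p f
      + 2 ^ (p - 1) * B ^ p * dirichletSum G p g := by
  have hf' := hf.mul_left (2 ^ (p - 1) * A ^ p)
  have hg' := hg.mul_left (2 ^ (p - 1) * B ^ p)
  have := (DirichletFinite.of_increment_le hp hA hB hf hg hk).tsum_le_tsum
    (gradPow_le_of_increment_le hp hA hB hk) (hf'.add hg')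
  rwa [hf'.tsum_add hg', tsum_mul_left, tsum_mul_left] at this

open Classical in
theorem eq_zero_of_notMem_closedNeighborhood {u : V → ℝ} (hu : (Function.support u).Finite)
    {x : V} (hx : x ∉ hu.toFinset ∪ hu.toFinset.biUnion fun y => G.neighborFinset y) :
    u x = 0 ∧ ∀ y, G.Adj x y → u y = 0 := by
  simp only [Finset.mem_union, Finset.mem_biUnion, Set.Finite.mem_toFinset,
    Function.mem_support, SimpleGraph.mem_neighborFinset, not_or, not_exists, not_and,
    not_not] at hx
  refine ⟨hx.1, fun y hy => ?_⟩
  by_contra h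
  exact hx.2 y h hy.symm

theorem DirichletFinite.of_finite_support (hp : 1 < p) {u : V → ℝ}
    (hu : (Function.support u).Finite) : DirichletFinite G p u := by
  classical
  refine summable_of_ne_finset_zero
    (s := hu.toFinset ∪ hu.toFinset.biUnion fun y => G.neighborFinset y) fun x hx => ?_
  obtain ⟨h1, h2⟩ := eq_zero_of_notMem_closedNeighborhood hu hx
  refine Finset.sum_eq_zero fun y hy => ?_
  rw [h1, h2 y ((G.mem_neighborFinset x y).1 hy)]
  simp [Real.zero_rpow (by linarith : p ≠ 0)]

/-! ### The first variation of the Dirichlet sum -/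

variable (G p) in
/-- The density at `x` of the derivative of the `p`-Dirichlet sum at `h` in direction `u`. -/
noncomputable def pairing (h u : V → ℝ) (x : V) : ℝ :=
  ∑ y ∈ G.neighborFinset x, |h y - h x| ^ (p - 2) * (h y - h x) * (u y - u x)

theorem tsum_pairing_eq_zero {h u : V → ℝ} (hh : IsPHarmonic G p h)
    (hu : (Function.support u).Finite) : ∑' x, pairing G p h u x = 0 := by
  classical
  set S := hu.toFinset with hS
  set T := S ∪ S.biUnion fun y => G.neighborFinset y with hT
  have hS0 : ∀ y, y ∉ S → u y = 0 := fun y hy => by simpa [hS] using hy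
  rw [tsum_eq_sum (s := T)]
  swap
  · intro x hx
    obtain ⟨h1, h2⟩ := eq_zero_of_notMem_closedNeighborhood hu hx
    refine Finset.sum_eq_zero fun y hy => ?_
    rw [h1, h2 y ((G.mem_neighborFinset x y).1 hy)]
    simp
  -- Harmonicity at `x` removes the `u x` terms. After exchanging the sums, the coefficient of `u y`
  -- is minus the Laplacian at `y`, again zero.
  have e1 : ∀ x, pairing G p h u x =
      ∑ y ∈ G.neighborFinset x with y ∈ S, |h y - h x| ^ (p - 2) * (h y - h x) * u y := by
    intro x
    have : ∑ y ∈ G.neighborFinset x, |h y - h x| ^ (p - 2) * (h y - h x) * u x = 0 := by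
      rw [← Finset.sum_mul]
      have := hh x
      rw [pLaplacian] at this
      rw [this, zero_mul]
    rw [pairing, Finset.sum_filter_of_ne]
    · simp_rw [mul_sub (_ * _) (u _) (u x)]
      rw [Finset.sum_sub_distrib, this, sub_zero]
    · intro y _ hy
      by_contra hc
      exact hy (by rw [hS0 y hc, mul_zero])
  simp only [e1]
  rw [Finset.sum_comm' (t' := S) (s' := fun y => G.neighborFinset y)]
  · refine Finset.sum_eq_zero fun y _ => ?_
    rw [← Finset.sum_mul]
    have := hh y
    rw [pLaplacian] at this
    have e2 : ∑ x ∈ G.neighborFinset y, |h y - h x| ^ (p - 2) * (h y - h x)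
        = -∑ x ∈ G.neighborFinset y, |h x - h y| ^ (p - 2) * (h x - h y) := by
      rw [← Finset.sum_neg_distrib]
      refine Finset.sum_congr rfl fun x _ => ?_
      rw [abs_sub_comm]; ring
    rw [e2, this, neg_zero, zero_mul]
  · intro x y
    simp only [hT, Finset.mem_union, Finset.mem_biUnion, Finset.mem_filter,
      SimpleGraph.mem_neighborFinset]
    constructor
    · rintro ⟨_, h1, h2⟩; exact ⟨h1.symm, h2⟩
    · rintro ⟨h1, h2⟩; exact ⟨Or.inr ⟨y, h2, h1⟩, h1.symm, h2⟩

/-- A crude Young inequality, by comparing `t` with `K * s`. The point is that `K ^ (1 - p) → 0` as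
`K → ∞`. -/
theorem rpow_mul_le_add (hp : 1 < p) {K s t : ℝ} (hK : 0 < K) (hs : 0 ≤ s) (ht : 0 ≤ t) :
    s ^ (p - 1) * t ≤ K * s ^ p + K ^ (1 - p) * t ^ p := by
  have hs1 : 0 ≤ K * s ^ p := by positivity
  have ht1 : 0 ≤ K ^ (1 - p) * t ^ p := by positivity
  have key : ∀ r : ℝ, 0 ≤ r → r ^ (p - 1) * r = r ^ p := fun r hr => by
    have := Real.rpow_add_one' hr (y := p - 1) (by linarith)
    rw [← this]; congr 1; ring
  rcases le_total t (K * s) with h | h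
  · have : s ^ (p - 1) * t ≤ s ^ (p - 1) * (K * s) := by gcongr
    have e := key s hs
    nlinarith
  · have h1 : s ≤ K⁻¹ * t := by
      rw [inv_mul_eq_div, le_div_iff₀ hK]; linarith
    have h2 : s ^ (p - 1) ≤ (K⁻¹ * t) ^ (p - 1) := Real.rpow_le_rpow hs h1 (by linarith)
    rw [Real.mul_rpow (by positivity) ht, Real.inv_rpow hK.le, ← Real.rpow_neg hK.le,
      neg_sub] at h2
    have h3 := mul_le_mul_of_nonneg_right h2 ht
    rw [mul_assoc, key t ht] at h3
    linarith

theorem abs_rpow_mul_self (r : ℝ) : |(|r| ^ (p - 2) * r)| ≤ |r| ^ (p - 1) := by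
  rcases eq_or_ne r 0 with rfl | hr
  · simp only [mul_zero, abs_zero]; positivity
  · rw [abs_mul, abs_of_nonneg (by positivity : 0 ≤ |r| ^ (p - 2)),
      ← Real.rpow_add_one (abs_ne_zero.2 hr)]
    apply le_of_eq; congr 1; ring

theorem abs_pairing_le (hp : 1 < p) {K : ℝ} (hK : 0 < K) (h u : V → ℝ) (x : V) :
    |pairing G p h u x| ≤ K * gradPow G p h x + K ^ (1 - p) * gradPow G p u x := by
  refine (Finset.abs_sum_le_sum_abs _ _).trans ?_
  simp only [gradPow, Finset.mul_sum]
  rw [← Finset.sum_add_distrib]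
  refine Finset.sum_le_sum fun y _ => ?_
  rw [abs_mul]
  exact (mul_le_mul_of_nonneg_right (abs_rpow_mul_self _) (abs_nonneg _)).trans
    (rpow_mul_le_add hp hK (abs_nonneg _) (abs_nonneg _))

theorem summable_pairing (hp : 1 < p) {h u : V → ℝ} (hh : DirichletFinite G p h)
    (hu : DirichletFinite G p u) : Summable (pairing G p h u) := by
  refine Summable.of_norm_bounded ((hh.mul_left 1).add (hu.mul_left (1 ^ (1 - p)))) fun x => ?_
  exact abs_pairing_le hp one_pos h u x

/-! ### Null functions -/

variable (G p) in
/-- `f` is a pointwise limit of finitely supported functions with bounded `p`-Dirichlet sums. -/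
def IsNull (f : V → ℝ) : Prop :=
  ∃ M : ℝ, ∃ u : ℕ → V → ℝ, (∀ n, (Function.support (u n)).Finite) ∧
    (∀ n, dirichletSum G p (u n) ≤ M) ∧ ∀ x, Tendsto (fun n => u n x) atTop (𝓝 (f x))

theorem isNull_zero (hp : 1 < p) : IsNull G p (0 : V → ℝ) := by
  refine ⟨0, fun _ => 0, by simp, fun _ => ?_, by simp⟩
  have : gradPow G p (0 : V → ℝ) = 0 := by
    funext x; simp [gradPow, Real.zero_rpow (by linarith : p ≠ 0)]
  simp [dirichletSum, this]

theorem IsNull.abs_mul_add_abs_mul (hp : 1 < p) {f g : V → ℝ} {A B : ℝ} (hA : 0 ≤ A)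
    (hB : 0 ≤ B) (hf : IsNull G p f) (hg : IsNull G p g) :
    IsNull G p fun x => A * |f x| + B * |g x| := by
  obtain ⟨M, u, hu, huM, hul⟩ := hf
  obtain ⟨N, v, hv, hvN, hvl⟩ := hg
  refine ⟨2 ^ (p - 1) * A ^ p * M + 2 ^ (p - 1) * B ^ p * N,
    fun n x => A * |u n x| + B * |v n x|, fun n => ?_, fun n => ?_, fun x => ?_⟩
  · refine ((hu n).union (hv n)).subset fun x hx => ?_
    by_contra hc
    simp only [Set.mem_union, Function.mem_support, not_or, not_not] at hc
    exact hx (by simp [hc.1, hc.2])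
  · refine (dirichletSum_le_of_increment_le hp hA hB (.of_finite_support hp (hu n))
      (.of_finite_support hp (hv n)) fun x y => ?_).trans (by gcongr; exacts [huM n, hvN n])
    have h1 := mul_le_mul_of_nonneg_left (abs_abs_sub_abs_le_abs_sub (u n y) (u n x)) hA
    have h2 := mul_le_mul_of_nonneg_left (abs_abs_sub_abs_le_abs_sub (v n y) (v n x)) hB
    calc _ = |A * (|u n y| - |u n x|) + B * (|v n y| - |v n x|)| := by congr 1; ring
      _ ≤ |A * (|u n y| - |u n x|)| + |B * (|v n y| - |v n x|)| := abs_add_le _ _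
      _ ≤ _ := by
        rw [abs_mul, abs_mul, abs_of_nonneg hA, abs_of_nonneg hB]; linarith
  · exact ((hul x).abs.const_mul A).add ((hvl x).abs.const_mul B)

/-- Capping `w` by `C * |u n|` makes the support finite, keeps the energy bounded, and loses nothing
in the limit. -/
theorem IsNull.of_le_mul (hp : 1 < p) {f w : V → ℝ} {C : ℝ} (hC : 0 ≤ C)
    (hf : IsNull G p f) (hw : DirichletFinite G p w) (hw0 : ∀ x, 0 ≤ w x)
    (hwf : ∀ x, w x ≤ C * |f x|) : IsNull G p w := by
  obtain ⟨M, u, hu, huM, hul⟩ := hf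
  refine ⟨2 ^ (p - 1) * 1 ^ p * dirichletSum G p w + 2 ^ (p - 1) * C ^ p * M,
    fun n x => min (w x) (C * |u n x|), fun n => ?_, fun n => ?_, fun x => ?_⟩
  · refine (hu n).subset fun x hx hc => hx ?_
    simp [hc, hw0 x]
  · refine (dirichletSum_le_of_increment_le hp zero_le_one hC hw
      (.of_finite_support hp (hu n)) fun x y => ?_).trans (by gcongr; exact huM n)
    have h1 := mul_le_mul_of_nonneg_left (abs_abs_sub_abs_le_abs_sub (u n y) (u n x)) hC
    refine (abs_min_sub_min_le_max _ _ _ _).trans ?_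
    have e : |(C * |u n y| - C * |u n x|)| = C * |(|u n y| - |u n x|)| := by
      rw [← mul_sub, abs_mul, abs_of_nonneg hC]
    rw [e]
    have := abs_nonneg (w y - w x)
    have := mul_nonneg hC (abs_nonneg (u n y - u n x))
    exact max_le (by linarith) (by linarith)
  · have := (tendsto_const_nhds (x := w x) (f := atTop)).min ((hul x).abs.const_mul C)
    rwa [min_eq_left (hwf x)] at this

/-- Only the pairings with `d n = w - u n` remain. These tend to 0 pointwise with bounded energy,
and Young's inequality replaces a weak compactness argument. -/
theorem IsNull.tsum_pairing_eq_zero (hp : 1 < p) {h w : V → ℝ} (hh : IsPHarmonic G p h)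
    (hhD : DirichletFinite G p h) (hw : DirichletFinite G p w) (hwn : IsNull G p w) :
    ∑' x, pairing G p h w x = 0 := by
  obtain ⟨M, u, hu, huM, hul⟩ := hwn
  have huD : ∀ n, DirichletFinite G p (u n) := fun n => .of_finite_support hp (hu n)
  set d : ℕ → V → ℝ := fun n x => w x - u n x with hd
  have hdinc : ∀ n x y, |d n y - d n x| ≤ 1 * |w y - w x| + 1 * |u n y - u n x| := by
    intro n x y
    rw [one_mul, one_mul]
    calc |d n y - d n x| = |(w y - w x) - (u n y - u n x)| := by
          congr 1; simp only [hd]; ring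
      _ ≤ _ := abs_sub _ _
  have hdD : ∀ n, DirichletFinite G p (d n) := fun n =>
    .of_increment_le hp zero_le_one zero_le_one hw (huD n) (hdinc n)
  set N : ℝ := 2 ^ (p - 1) * 1 ^ p * dirichletSum G p w + 2 ^ (p - 1) * 1 ^ p * M with hN
  have hdN : ∀ n, dirichletSum G p (d n) ≤ N := fun n =>
    (dirichletSum_le_of_increment_le hp zero_le_one zero_le_one hw (huD n) (hdinc n)).trans
      (by rw [hN]; gcongr; exact huM n)
  have hpd : ∀ n x, pairing G p h (d n) x = pairing G p h w x - pairing G p h (u n) x := by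
    intro n x
    simp only [pairing, ← Finset.sum_sub_distrib]
    refine Finset.sum_congr rfl fun y _ => ?_
    simp only [hd]; ring
  have htsum : ∀ n, ∑' x, pairing G p h w x = ∑' x, pairing G p h (d n) x := by
    intro n
    simp only [hpd]
    rw [(summable_pairing hp hhD hw).tsum_sub (summable_pairing hp hhD (huD n)),
      PHarmonic.tsum_pairing_eq_zero hh (hu n), sub_zero]
  have hlim : ∀ x, Tendsto (fun n => pairing G p h (d n) x) atTop (𝓝 0) := by
    intro x
    have h1 : ∀ z, Tendsto (fun n => d n z) atTop (𝓝 0) := fun z => by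
      have := (tendsto_const_nhds (x := w z)).sub (hul z)
      rwa [sub_self] at this
    have : Tendsto (fun n => pairing G p h (d n) x) atTop
        (𝓝 (∑ y ∈ G.neighborFinset x, |h y - h x| ^ (p - 2) * (h y - h x) * (0 - 0))) :=
      tendsto_finsetSum _ fun y _ => ((h1 y).sub (h1 x)).const_mul _
    simpa using this
  have hbound : ∀ K : ℝ, 0 < K → |∑' x, pairing G p h w x| ≤ K ^ (1 - p) * N := by
    intro K hK
    -- The part of the pairing not absorbed by the energy of `d n` is dominated by `K * gradPow G p
    -- h`, so its sum tends to 0. The absorbed part costs at most `K ^ (1 - p) * N`, which vanishes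
    -- as `K → ∞`.
    set e : ℕ → V → ℝ := fun n x =>
      max (|pairing G p h (d n) x| - K ^ (1 - p) * gradPow G p (d n) x) 0 with he
    have heb : ∀ n x, ‖e n x‖ ≤ K * gradPow G p h x := by
      intro n x
      rw [Real.norm_of_nonneg (le_max_right _ _)]
      refine max_le ?_ (mul_nonneg hK.le (gradPow_nonneg h x))
      linarith [abs_pairing_le hp hK h (d n) x (G := G)]
    have het : Tendsto (fun n => ∑' x, e n x) atTop (𝓝 (∑' _ : V, (0 : ℝ))) := by
      refine tendsto_tsum_of_dominated_convergence (hhD.mul_left K) (fun x => ?_)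
        (Eventually.of_forall fun n x => heb n x)
      refine tendsto_of_tendsto_of_tendsto_of_le_of_le tendsto_const_nhds
        (by simpa using (hlim x).abs) (fun n => le_max_right _ _) fun n => ?_
      have := mul_nonneg (Real.rpow_nonneg hK.le (1 - p)) (gradPow_nonneg (G := G) (p := p) (d n) x)
      exact max_le (by linarith) (abs_nonneg _)
    rw [tsum_zero] at het
    have hle : ∀ n, |∑' x, pairing G p h w x| ≤ (∑' x, e n x) + K ^ (1 - p) * N := by
      intro n
      have hes : Summable (e n) := Summable.of_norm_bounded (hhD.mul_left K) (heb n)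
      have hgs := (hdD n).mul_left (K ^ (1 - p))
      rw [htsum n]
      calc |∑' x, pairing G p h (d n) x|
          ≤ ∑' x, |pairing G p h (d n) x| := by
            have := norm_tsum_le_tsum_norm (summable_pairing hp hhD (hdD n)).norm
            simpa only [Real.norm_eq_abs] using this
        _ ≤ ∑' x, (e n x + K ^ (1 - p) * gradPow G p (d n) x) := by
            refine (summable_pairing hp hhD (hdD n)).abs.tsum_le_tsum (fun x => ?_) (hes.add hgs)
            have := le_max_left (|pairing G p h (d n) x| - K ^ (1 - p) * gradPow G p (d n) x) 0
            simp only [he]; linarith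
        _ = (∑' x, e n x) + K ^ (1 - p) * dirichletSum G p (d n) := by
            rw [hes.tsum_add hgs, tsum_mul_left]; rfl
        _ ≤ _ := by gcongr; exact hdN n
    have := ge_of_tendsto' (het.add_const (K ^ (1 - p) * N)) hle
    rwa [zero_add] at this
  have hK0 : Tendsto (fun K : ℝ => K ^ (1 - p) * N) atTop (𝓝 0) := by
    have := (tendsto_rpow_neg_atTop (by linarith : 0 < p - 1)).mul_const N
    rwa [zero_mul, neg_sub] at this
  have := ge_of_tendsto hK0 ((eventually_gt_atTop 0).mono hbound)
  exact abs_nonpos_iff.1 this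

/-- The norm controls the value at `o` and every edge increment, so norm convergence is pointwise
along paths to `o`. -/
theorem isNull_of_mem_bddClosureFinSupp (hconn : G.Connected) {hp : 1 < p} {o : V}
    {f : BD G hp} (hf : f ∈ bddClosureFinSupp G hp o) : IsNull G p (f : V → ℝ) := by
  have hp0 : 0 < p := by linarith
  have hfD : DirichletFinite G p (f : V → ℝ) := f.2.1
  choose g hg hgn using fun n : ℕ => hf (1 / ((n : ℝ) + 1)) (by positivity)
  have hgD : ∀ n, DirichletFinite G p (g n) := fun n => .of_finite_support hp (hg n)
  have hdD : ∀ n, DirichletFinite G p ((f : V → ℝ) - g n) := fun n =>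
    .of_increment_le hp zero_le_one zero_le_one hfD (hgD n) fun x y => by
      rw [one_mul, one_mul]
      calc _ = |((f : V → ℝ) y - (f : V → ℝ) x) - (g n y - g n x)| := by
            congr 1; simp only [Pi.sub_apply]; ring
        _ ≤ _ := abs_sub _ _
  have hsum : ∀ n : ℕ, dirichletSum G p ((f : V → ℝ) - g n) + |((f : V → ℝ) - g n) o| ^ p
      ≤ (1 / ((n : ℝ) + 1)) ^ p := by
    intro n
    have h0 : 0 ≤ dirichletSum G p ((f : V → ℝ) - g n) + |((f : V → ℝ) - g n) o| ^ p :=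
      add_nonneg (dirichletSum_nonneg _) (by positivity)
    have := Real.rpow_le_rpow (by unfold dirichletNorm; positivity) (hgn n).le hp0.le
    rwa [dirichletNorm, ← Real.rpow_mul h0, one_div_mul_cancel hp0.ne', Real.rpow_one] at this
  have hinc : ∀ n x y, G.Adj x y →
      |((f : V → ℝ) - g n) y - ((f : V → ℝ) - g n) x| ≤ 1 / ((n : ℝ) + 1) := by
    intro n x y hxy
    have h1 := abs_sub_rpow_le_gradPow (p := p) ((f : V → ℝ) - g n) hxy
    have h2 := (hdD n).le_tsum x fun z _ => gradPow_nonneg _ z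
    have h3 : 0 ≤ |((f : V → ℝ) - g n) o| ^ p := by positivity
    have h4 := hsum n
    rw [dirichletSum] at h4
    exact (Real.rpow_le_rpow_iff (abs_nonneg _) (by positivity) hp0).1 (by linarith)
  have hbase : ∀ n, |((f : V → ℝ) - g n) o| ≤ 1 / ((n : ℝ) + 1) := fun n =>
    (Real.rpow_le_rpow_iff (abs_nonneg _) (by positivity) hp0).1
      (by linarith [hsum n, dirichletSum_nonneg (G := G) (p := p) ((f : V → ℝ) - g n)])
  have hlim : ∀ x, Tendsto (fun n => ((f : V → ℝ) - g n) x) atTop (𝓝 0) := by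
    intro x
    obtain ⟨q⟩ := hconn.preconnected x o
    induction q with
    | nil => exact squeeze_zero_norm hbase tendsto_one_div_add_atTop_nhds_zero_nat
    | @cons x y z hadj _ ih =>
      have h1 : Tendsto (fun n => ((f : V → ℝ) - g n) y - ((f : V → ℝ) - g n) x) atTop (𝓝 0) :=
        squeeze_zero_norm (fun n => hinc n x y hadj) tendsto_one_div_add_atTop_nhds_zero_nat
      have := (ih hf hgn hsum hbase).sub h1
      simpa using this
  refine ⟨2 ^ (p - 1) * 1 ^ p * dirichletSum G p (f : V → ℝ) + 2 ^ (p - 1) * 1 ^ p * 1, g, hg,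
    fun n => ?_, fun x => ?_⟩
  · refine (dirichletSum_le_of_increment_le hp zero_le_one zero_le_one hfD (hdD n)
      fun x y => ?_).trans ?_
    · rw [one_mul, one_mul]
      calc |g n y - g n x| = |((f : V → ℝ) y - (f : V → ℝ) x)
            - (((f : V → ℝ) - g n) y - ((f : V → ℝ) - g n) x)| := by
            congr 1; simp only [Pi.sub_apply]; ring
        _ ≤ _ := abs_sub _ _
    · have h1 : (1 / ((n : ℝ) + 1)) ^ p ≤ 1 :=
        Real.rpow_le_one (by positivity)
          (by rw [div_le_one (by positivity)]; linarith [n.cast_nonneg (α := ℝ)]) hp0.le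
      have h2 : 0 ≤ |((f : V → ℝ) - g n) o| ^ p := by positivity
      gcongr
      linarith [hsum n]
  · have := (tendsto_const_nhds (x := (f : V → ℝ) x)).sub (hlim x)
    simpa using this

/-! ### Boundary characters from ultrafilters -/

variable (G) in
/-- The filter of neighbourhoods of the `p`-harmonic boundary: a set belongs to it when some null
function is at least `1` off the set. -/
def nullFilter (hp : 1 < p) : Filter V where
  sets := {s | ∃ f, IsNull G p f ∧ ∀ x ∉ s, 1 ≤ f x}
  univ_sets := ⟨0, isNull_zero hp, fun x hx => absurd (Set.mem_univ x) hx⟩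
  sets_of_superset := by
    rintro s t ⟨f, hf, hfs⟩ hst
    exact ⟨f, hf, fun x hx => hfs x fun h => hx (hst h)⟩
  inter_sets := by
    rintro s t ⟨f, hf, hfs⟩ ⟨g, hg, hgt⟩
    refine ⟨_, hf.abs_mul_add_abs_mul hp zero_le_one zero_le_one hg, fun x hx => ?_⟩
    have h1 := abs_nonneg (f x)
    have h2 := abs_nonneg (g x)
    by_cases hxs : x ∈ s
    · have := hgt x fun h => hx ⟨hxs, h⟩
      linarith [le_abs_self (g x)]
    · linarith [hfs x hxs, le_abs_self (f x)]

theorem IsNull.tendsto_nullFilter (hp : 1 < p) {f : V → ℝ} (hf : IsNull G p f) :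
    Tendsto f (nullFilter G hp) (𝓝 0) := by
  rw [Metric.tendsto_nhds]
  intro δ hδ
  -- The null function `δ⁻¹ * |f|` is at least 1 wherever `|f| ≥ δ`.
  refine ⟨_, hf.abs_mul_add_abs_mul hp (inv_nonneg.2 hδ.le) le_rfl (isNull_zero hp),
    fun x hx => ?_⟩
  have hx' : δ ≤ |f x| := by simpa [Real.dist_eq] using hx
  have : 1 ≤ δ⁻¹ * |f x| := by
    rw [inv_mul_eq_div, le_div_iff₀ hδ]; linarith
  simpa using this

theorem exists_tendsto_of_bounded (U : Ultrafilter V) {f : V → ℝ} (hf : ∃ M, ∀ x, |f x| ≤ M) :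
    ∃ l, Tendsto f U (𝓝 l) := by
  obtain ⟨M, hM⟩ := hf
  have : (↑(U.map f) : Filter ℝ) ≤ 𝓟 (Set.Icc (-M) M) := by
    rw [le_principal_iff]
    exact Filter.mem_map.2 (univ_mem' fun x => abs_le.1 (hM x))
  obtain ⟨l, _, hl⟩ := isCompact_Icc.ultrafilter_le_nhds (U.map f) this
  exact ⟨l, hl⟩

theorem exists_character_of_ultrafilter (hp : 1 < p) (U : Ultrafilter V) :
    ∃ τ : Spectrum G hp, ∀ (f : BD G hp) (l : ℝ), Tendsto (f : V → ℝ) U (𝓝 l) → τ f = l := by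
  choose L hL using fun f : BD G hp => exists_tendsto_of_bounded U f.2.2
  have hu : ∀ (f : BD G hp) (l : ℝ), Tendsto (f : V → ℝ) U (𝓝 l) → L f = l :=
    fun f l hl => tendsto_nhds_unique (hL f) hl
  have hc : ∀ c : ℝ, L (algebraMap ℝ (BD G hp) c) = c := fun c => hu _ _ tendsto_const_nhds
  let φ : BD G hp →ₐ[ℝ] ℝ :=
    { toFun := L
      map_one' := by simpa using hc 1
      map_zero' := by simpa using hc 0
      map_mul' := fun f g => hu _ _ ((hL f).mul (hL g))
      map_add' := fun f g => hu _ _ ((hL f).add (hL g))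
      commutes' := hc }
  refine ⟨Complex.ofRealAm.comp φ, fun f l hl => ?_⟩
  change ((L f : ℝ) : ℂ) = l
  rw [hu f l hl]

/-- The indicator of `{x}` is finitely supported, but evaluation at `x` sends it to 1. -/
theorem mem_roydenBoundary_of_vanish {hp : 1 < p} {o : V} {τ : Spectrum G hp}
    (hτ : ∀ f ∈ bddClosureFinSupp G hp o, gelfand G f τ = 0) : τ ∈ roydenBoundary G hp := by
  classical
  rintro ⟨x, rfl⟩
  have hs : (Function.support (Pi.single x (1 : ℝ) : V → ℝ)).Finite :=
    (Set.finite_singleton x).subset (by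
      intro y hy
      by_contra hc
      exact hy (Pi.single_eq_of_ne hc _))
  let δ : BD G hp := ⟨Pi.single x 1, .of_finite_support hp hs, 1, fun y => by
    rcases eq_or_ne y x with rfl | hy
    · simp
    · simp [hy]⟩
  have hδ : δ ∈ bddClosureFinSupp G hp o := by
    intro ε hε
    refine ⟨Pi.single x 1, hs, ?_⟩
    have hp0 : p ≠ 0 := by linarith
    have h0 : gradPow G p (0 : V → ℝ) = 0 := by
      funext x; simp [gradPow, Real.zero_rpow hp0]
    have h1 : (δ : V → ℝ) - Pi.single x 1 = 0 := sub_self _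
    rw [h1]
    simpa [dirichletNorm, dirichletSum, h0, Real.zero_rpow hp0, hp0] using hε
  have h1 := hτ δ hδ
  have h2 : gelfand G δ (evalChar G hp x) = ((Pi.single x (1 : ℝ) : V → ℝ) x : ℂ) := rfl
  rw [h2] at h1
  simp at h1

/-! ### Comparison and the maximum principle -/

/-- Truncation is decreasing and 1-Lipschitz: its increment `e` opposes `t - s` in sign and is no
larger, so the right side is `|t - s| ^ (p - 1) * |e|`. -/
theorem rpow_le_of_truncation (hp : 1 < p) (c s t : ℝ) :
    |max (c - t) 0 - max (c - s) 0| ^ p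
      ≤ -(|t - s| ^ (p - 2) * (t - s) * (max (c - t) 0 - max (c - s) 0)) := by
  set e := max (c - t) 0 - max (c - s) 0 with he
  have hle : |e| ≤ |t - s| := by
    refine (abs_max_sub_max_le_abs _ _ _).trans (le_of_eq ?_)
    rw [← abs_neg]; congr 1; ring
  have hsign : -((t - s) * e) = |t - s| * |e| := by
    rcases le_total s t with h | h
    · have : e ≤ 0 := sub_nonpos.2 (max_le_max (by linarith) le_rfl)
      rw [abs_of_nonneg (sub_nonneg.2 h), abs_of_nonpos this]; ring
    · have : 0 ≤ e := sub_nonneg.2 (max_le_max (by linarith) le_rfl)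
      rw [abs_of_nonpos (sub_nonpos.2 h), abs_of_nonneg this]; ring
  rw [mul_assoc, ← mul_neg, hsign, ← mul_assoc]
  rcases eq_or_ne (t - s) 0 with h0 | h0
  · have : |e| = 0 := le_antisymm (by simpa [h0] using hle) (abs_nonneg _)
    rw [this, Real.zero_rpow (by linarith), mul_zero]
  · rw [← Real.rpow_add_one (abs_ne_zero.2 h0), show p - 2 + 1 = p - 1 by ring]
    have h1 : |e| ^ p = |e| ^ (p - 1) * |e| := by
      rw [← Real.rpow_add_one' (abs_nonneg e) (by linarith)]; congr 1; ring
    rw [h1]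
    gcongr

theorem le_of_isNull_truncation (hconn : G.Connected) (hp : 1 < p) {h : V → ℝ}
    (hh : IsPHarmonic G p h) (hhD : DirichletFinite G p h)
    (hnonconst : ¬ ∃ c : ℝ, ∀ x, h x = c) {c : ℝ}
    (hw : DirichletFinite G p fun x => max (c - h x) 0)
    (hwn : IsNull G p fun x => max (c - h x) 0) (x : V) : c ≤ h x := by
  set w : V → ℝ := fun x => max (c - h x) 0 with hwdef
  have h0 := hwn.tsum_pairing_eq_zero hp hh hhD hw
  have hle : ∀ x, gradPow G p w x ≤ -pairing G p h w x := by
    intro x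
    rw [gradPow, pairing, ← Finset.sum_neg_distrib]
    exact Finset.sum_le_sum fun y _ => rpow_le_of_truncation hp c (h x) (h y)
  have h1 : dirichletSum G p w ≤ 0 := by
    have := hw.tsum_le_tsum hle (summable_pairing hp hhD hw).neg
    rwa [tsum_neg, h0, neg_zero] at this
  have hadj : ∀ x y, G.Adj x y → w y = w x := by
    intro x y hxy
    have h2 := abs_sub_rpow_le_gradPow (p := p) w hxy
    have h3 := hw.le_tsum x fun z _ => gradPow_nonneg w z
    rw [dirichletSum] at h1
    have h4 : |w y - w x| ^ p = 0 := le_antisymm (by linarith) (by positivity)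
    have h5 := (Real.rpow_eq_zero (abs_nonneg _) (by linarith)).1 h4
    exact sub_eq_zero.1 (abs_eq_zero.1 h5)
  by_contra hc
  push Not at hc
  refine hnonconst ⟨h x, fun y => ?_⟩
  have h6 : max (c - h y) 0 = max (c - h x) 0 := eq_of_forall_adj hconn hadj x y
  rw [max_eq_left (by linarith : 0 ≤ c - h x)] at h6
  rcases max_choice (c - h y) 0 with h7 | h7 <;> rw [h7] at h6 <;> linarith

/-- Where the minimum is attained, the Laplacian is a vanishing sum of nonnegative terms, so the
minimum spreads to all neighbors. -/
theorem lt_of_forall_le (hconn : G.Connected) {h : V → ℝ}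
    (hh : IsPHarmonic G p h) (hnonconst : ¬ ∃ c : ℝ, ∀ x, h x = c) {a : ℝ}
    (ha : ∀ x, a ≤ h x) (x : V) : a < h x := by
  refine lt_of_le_of_ne (ha x) fun hx => hnonconst ⟨a, fun z => ?_⟩
  have hstep : ∀ x y, G.Adj x y → h x = a → h y = a := by
    intro x y hxy hx
    have h1 := (Finset.sum_eq_zero_iff_of_nonneg fun y _ =>
      mul_nonneg (by positivity) (sub_nonneg.2 (hx ▸ ha y))).1 (hh x) y
      ((G.mem_neighborFinset x y).2 hxy)
    rcases mul_eq_zero.1 h1 with h2 | h2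
    · by_contra hne
      have : 0 < |h y - h x| := abs_pos.2 (sub_ne_zero.2 fun e => hne (e.trans hx))
      exact (Real.rpow_pos_of_pos this _).ne' h2
    · linarith
  obtain ⟨q⟩ := hconn.preconnected x z
  induction q with
  | nil => exact hx.symm
  | cons hadj _ ih => exact ih (hstep _ _ hadj hx.symm).symm

theorem lt_of_le_gelfand (hconn : G.Connected) {hp : 1 < p} {o : V} {h : BD G hp}
    (hh : h ∈ BHD G hp) (hnonconst : ¬ ∃ c : ℝ, ∀ x, (h : V → ℝ) x = c) {a : ℝ}
    (ha : ∀ τ ∈ harmonicBoundary G hp o, a ≤ (gelfand G h τ).re) (x : V) :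
    a < (h : V → ℝ) x := by
  refine lt_of_forall_le hconn hh hnonconst (fun x => le_of_forall_lt_imp_le_of_dense
    fun c hc => ?_) x
  obtain ⟨hhD, M, hM⟩ := h.2
  have hwD : DirichletFinite G p fun x => max (c - (h : V → ℝ) x) 0 :=
    .of_increment_le hp zero_le_one zero_le_one hhD hhD fun x y => by
      have h1 := abs_max_sub_max_le_abs (c - (h : V → ℝ) y) (c - (h : V → ℝ) x) 0
      rw [sub_sub_sub_cancel_left, abs_sub_comm ((h : V → ℝ) x)] at h1
      linarith [abs_nonneg ((h : V → ℝ) y - (h : V → ℝ) x)]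
  refine le_of_isNull_truncation hconn hp hh hhD hnonconst hwD ?_ x
  by_cases hmem : {x | (h : V → ℝ) x ≤ c}ᶜ ∈ nullFilter G hp
  · obtain ⟨f, hf, hf1⟩ := hmem
    -- `|c| + M` bounds `c - h`, and the truncation vanishes where `f` may be less than 1.
    refine hf.of_le_mul hp (abs_nonneg (|c| + M)) hwD (fun x => le_max_right _ _) fun x => ?_
    by_cases hx : (h : V → ℝ) x ≤ c
    · have h1 : 1 ≤ |f x| := (hf1 x fun hn => hn hx).trans (le_abs_self _)
      have h2 := (abs_le.1 (hM x)).1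
      have h3 : c - (h : V → ℝ) x ≤ |(|c| + M)| := by
        linarith [le_abs_self c, le_abs_self (|c| + M)]
      exact (max_le h3 (abs_nonneg _)).trans (le_mul_of_one_le_right (abs_nonneg _) h1)
    · have : max (c - (h : V → ℝ) x) 0 = 0 := max_eq_right (by linarith)
      rw [this]; positivity
  · exfalso
    have : NeBot (nullFilter G hp ⊓ 𝓟 {x | (h : V → ℝ) x ≤ c}) :=
      ⟨fun hbot => hmem (mem_iff_inf_principal_compl.2 (by rwa [compl_compl]))⟩
    obtain ⟨U, hU⟩ := Ultrafilter.exists_le (nullFilter G hp ⊓ 𝓟 {x | (h : V → ℝ) x ≤ c})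
    obtain ⟨τ, hτ⟩ := exists_character_of_ultrafilter (G := G) hp U
    have hvan : ∀ f ∈ bddClosureFinSupp G hp o, gelfand G f τ = 0 := fun f hf =>
      (hτ f 0 (((isNull_of_mem_bddClosureFinSupp hconn hf).tendsto_nullFilter hp).mono_left
        (hU.trans inf_le_left))).trans Complex.ofReal_zero
    have h1 := ha τ ⟨mem_roydenBoundary_of_vanish hvan, hvan⟩
    obtain ⟨l, hl⟩ := exists_tendsto_of_bounded U h.2.2
    have h2 : l ≤ c := le_of_tendsto hl (hU (mem_inf_of_right (mem_principal_self _)))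
    rw [gelfand, hτ h l hl, Complex.ofReal_re] at h1
    linarith

theorem neg_mem_BHD {hp : 1 < p} {h : BD G hp} (hh : h ∈ BHD G hp) : -h ∈ BHD G hp := by
  intro x
  have e : pLaplacian G p (-h : BD G hp) x = -pLaplacian G p h x := by
    rw [pLaplacian, pLaplacian, ← Finset.sum_neg_distrib]
    refine Finset.sum_congr rfl fun y _ => ?_
    have : ((-h : BD G hp) : V → ℝ) y - ((-h : BD G hp) : V → ℝ) x
        = -((h : V → ℝ) y - (h : V → ℝ) x) := by
      change -(h : V → ℝ) y - -(h : V → ℝ) x = _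
      ring
    rw [this, abs_neg, mul_neg]
  rw [e, hh x, neg_zero]

end PHarmonic

theorem theorem4p6 {V : Type*} [Countable V] [Infinite V]
    (G : SimpleGraph V) [G.LocallyFinite] (hconn : G.Connected)
    (hdeg : ∃ k : ℕ, ∀ x, G.degree x ≤ k)
    (p : ℝ) (hp : 1 < p) (o : V)
    (h : PHarmonic.BD G hp) (hh : h ∈ PHarmonic.BHD G hp)
    (hnonconst : ¬ ∃ c : ℝ, ∀ x, (h : V → ℝ) x = c)
    (a b : ℝ)
    (hab : ∀ τ ∈ PHarmonic.harmonicBoundary G hp o,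
      a ≤ (PHarmonic.gelfand G h τ).re ∧ (PHarmonic.gelfand G h τ).re ≤ b) :
    ∀ x : V, a < (h : V → ℝ) x ∧ (h : V → ℝ) x < b := by
  have hneg := PHarmonic.lt_of_le_gelfand (a := -b) (o := o) hconn
    (PHarmonic.neg_mem_BHD hh)
    (fun ⟨c, hc⟩ => hnonconst ⟨-c, fun x => neg_eq_iff_eq_neg.1 (hc x)⟩)
    fun τ hτ => by
      have := (hab τ hτ).2
      rw [PHarmonic.gelfand, map_neg, Complex.neg_re]
      exact neg_le_neg this
  exact fun x => ⟨PHarmonic.lt_of_le_gelfand hconn hh hnonconst (fun τ hτ => (hab τ hτ).1) x,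
    neg_lt_neg_iff.1 (hneg x)⟩
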